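/- Let $\mathtt a<\mathtt b$ be letters. For a word $v=v[0]\cdots v[n-1]$ over an ordered alphabet, $\mathrm{BWT}(v)$ is the word obtained by sorting the $n$ rotations of $v$ lexicographically (equal rotations by their starting position) and concatenating their last letters in this order; $\mathrm{runs}(v)$ is the number of maximal equal-letter runs of $v$; and $r_\$(v)=\mathrm{runs}(\mathrm{BWT}(v\$))$, where $\$$ is an additional letter smaller than all others. For a non-empty word $v$ let $\widehat v$ be $v$ without its last letter. For $k>5$ let $$w_k=\Big(\prod_{i=2}^{k-1}\mathtt a\mathtt b^i\mathtt a\mathtt a\cdot\mathtt a\mathtt b^i\mathtt a\mathtt b\mathtt a^{i-2}\Big)\mathtt a\mathtt b^k\mathtt a .$$ **Proposition.** The family $\mathcal F=\{w_k\mathtt b : k>5\}$ is an infinite set of words such that, for $w\in\mathcal F$ and $n=|w|$, 1. $r_\$(w\mathtt b)-r_\$(w)=\Theta(\sqrt n)$; 2. $r_\$(\widehat w)-r_\$(w)=\Theta(\sqrt n)$; 3. $r_\$(\widehat w\,\mathtt a)-r_\$(w)=\Theta(\sqrt n)$. Here $f(w)=\Theta(\sqrt n)$ means that there are constants $c,C>0$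 with $c\sqrt n\le f(w)\le C\sqrt n$ for all $w\in\mathcal F$; in particular each of the three edits strictly increases $r_\$$. -/

import Mathlib

namespace BWTRuns

section Words

variable {α : Type*} [LinearOrder α]

/-- The conjugate array of `w`: the positions `0, …, |w| - 1`, sorted by the lexicographic order of
the rotations `conj_i(w) = w[i..] w[..i-1]` that start there, equal rotations being sorted by their
position. -/
def conjArray (w : List α) : List ℕ :=
  (List.range w.length).mergeSort
    (fun i j => decide (toLex (w.rotate i, i) ≤ toLex (w.rotate j, j)))

/-- The Burrows-Wheeler transform of `w`: its `i`-th letter is the letter of `w` that cyclically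
precedes the position `CA[i]`. (All the indices are in range, so `filterMap` drops no entry.) -/
def bwt (w : List α) : List α :=
  (conjArray w).filterMap (fun i => w[if i = 0 then w.length - 1 else i - 1]?)

/-- The number of maximal equal-letter runs of a word. -/
def runs (v : List α) : ℕ := (v.splitBy (fun x y => decide (x = y))).length

/-- The word `w$`, over the alphabet enlarged by a new smallest letter `$ = ⊥`. -/
def withDollar (w : List α) : List (WithBot α) := w.map (fun x => (x : WithBot α)) ++ [⊥]

/-- `r_$(w)`, the number of runs of the Burrows-Wheeler transform of `w$`. -/
def rDollar (w : List α) : ℕ := runs (bwt (withDollar w))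

end Words

/-- The binary alphabet `{a, b}` with `a < b` is `Bool` with `false < true`. -/
abbrev Letter : Type := Bool

/-- The letter `a`. -/
abbrev a : Letter := false

/-- The letter `b`. -/
abbrev b : Letter := true

/-- `s_i = a b^i a a`. -/
def s (i : ℕ) : List Letter := [a] ++ List.replicate i b ++ [a, a]

/-- `e_i = a b^i a b a^(i-2)`, used for `i ≥ 2`. -/
def e (i : ℕ) : List Letter :=
  [a] ++ List.replicate i b ++ [a, b] ++ List.replicate (i - 2) a

/-- `q_k = a b^k a`. -/
def q (k : ℕ) : List Letter := [a] ++ List.replicate k b ++ [a]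

/-- `w_k = (∏_{i=2}^{k-1} s_i e_i) q_k`; the list `List.range' 2 (k - 2)` is `[2, …, k - 1]`. -/
def wk (k : ℕ) : List Letter := (List.range' 2 (k - 2)).flatMap (fun i => s i ++ e i) ++ q k

/-- The family of the words `w_k b` for `k > 5`. -/
def family : Set (List Letter) := {w | ∃ k : ℕ, 5 < k ∧ w = wk k ++ [b]}

/-- `f(w) = Θ(√n)` for the words `w` of the family `F`, where `n = |w|`: there are positive
constants with `c √n ≤ f(w) ≤ C √n` throughout the family (so `f` is positive there). -/
def IsThetaSqrtLength (F : Set (List Letter)) (f : List Letter → ℤ) : Prop :=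
  ∃ c C : ℝ, 0 < c ∧ 0 < C ∧ ∀ w ∈ F,
    c * Real.sqrt (w.length : ℝ) ≤ (f w : ℝ) ∧ (f w : ℝ) ≤ C * Real.sqrt (w.length : ℝ)

end BWTRuns

/-! Sorting the rotations of `v$` amounts to sorting the suffixes of `v`, so `r_$` counts the runs
of preceding letters along the sorted suffixes. Write the words in question as `w_k x` with `x` one
of `b`, `bb`, the empty word, `a`, and split the suffixes into base suffixes, which start at or
before the last block `a b^k`, and the `k + 2 + |x|` later ones. As `b^k` occurs only in that block,
base suffixes are compared before `x` is reached, so `baseRuns k x` does not depend on `x`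
(`baseRuns_eq`). Each later suffix adds at most two runs (`rDollar_le`).

For `2 ≤ m ≤ k - 2` the base suffixes `b^m · tailE_m` and `b^(m+1) · tailS_(m+1)` are adjacent, and
both are preceded by `a` (`IsBaseSuffix.le_or_le`). If `x` is `bb`, empty or `a`, a suffix of the
last block preceded by `b` falls strictly inside each of these `k - 3` gaps and creates two runs
(`le_rDollar_of_between`).

If `x = b`, the final `b^(k-1) a b` also occurs in `e_(k-1)`, followed by the least non-empty
suffix. Sending each later suffix, with two exceptions, to its copy there preserves preceding
letters and order, so no new runs arise and `r_$(w_k b) ≤ baseRuns + 4` (`rDollar_append_b_le`).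

Each difference thus lies between `2k - 10` and `2k + 8`, while `|w_k|` is quadratic in `k`. -/

namespace BWTRuns

/-! ### Runs of a word under insertion of a letter -/

section Runs

variable {β : Type*} [LinearOrder β]

theorem length_splitBy_loop (l : List β) (c : β) (g : List β) (gs : List (List β)) :
    (List.splitBy.loop (fun x y => decide (x = y)) l c g gs).length =
      gs.length + (l.destutter' (· ≠ ·) c).length := by
  induction l generalizing c g gs with
  | nil => simp [List.splitBy.loop]
  | cons d l ih =>
    by_cases h : c = d
    · subst h
      simp [List.splitBy.loop, ih]
    · simp [List.splitBy.loop, ih, h]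
      omega

theorem runs_eq_length_destutter (v : List β) : runs v = (v.destutter (· ≠ ·)).length := by
  cases v with
  | nil => simp [runs, List.splitBy]
  | cons c l => simp [runs, List.splitBy, length_splitBy_loop, List.destutter_cons']

theorem runs_cons_cons (c d : β) (l : List β) :
    runs (c :: d :: l) = runs (d :: l) + if c = d then 0 else 1 := by
  simp only [runs_eq_length_destutter, List.destutter_cons', List.destutter'_cons]
  by_cases h : c = d
  · simp [h]
  · simp [h]

theorem runs_le_runs_cons (c : β) (l : List β) : runs l ≤ runs (c :: l) := by
  cases l with
  | nil => simp [runs_eq_length_destutter]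
  | cons d l => simp [runs_cons_cons]

theorem runs_cons_le (c : β) (l : List β) : runs (c :: l) ≤ runs l + 1 := by
  cases l with
  | nil => simp [runs_eq_length_destutter]
  | cons d l => rw [runs_cons_cons]; split_ifs <;> omega

theorem runs_append_cons_le (u v : List β) (c : β) :
    runs (u ++ c :: v) ≤ runs (u ++ v) + 2 := by
  induction u with
  | nil => exact (runs_cons_le c v).trans (by simp)
  | cons d u ih =>
    cases u with
    | nil =>
      have h1 := runs_cons_le d (c :: v)
      have h2 := runs_cons_le c v
      have h3 := runs_le_runs_cons d v
      simp only [List.cons_append, List.nil_append]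
      omega
    | cons e u =>
      simp only [List.cons_append, runs_cons_cons] at ih ⊢
      omega

theorem runs_append_between (u v : List β) {c d : β} (h : c ≠ d) :
    runs (u ++ c :: d :: c :: v) = runs (u ++ c :: c :: v) + 2 := by
  induction u with
  | nil => simp [runs_cons_cons, h, h.symm]
  | cons e u ih =>
    cases u with
    | nil =>
      simp [runs_cons_cons, h, h.symm]
      omega
    | cons f u =>
      simp only [List.cons_append, runs_cons_cons] at ih ⊢
      omega

end Runs

/-! ### Runs of labels read in the order of keys -/

section SortedRuns

variable {ι ι' κ κ' β : Type*} [LinearOrder κ] [LinearOrder κ'] [LinearOrder β]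

/-- The number of runs of the labels `f`, read along the indices of `l` in the order of the keys. -/
def sortedRuns (key : ι → κ) (f : ι → β) (l : List ι) : ℕ :=
  runs ((l.mergeSort (fun i j => decide (key i ≤ key j))).map f)

theorem pairwise_mergeSort_key (key : ι → κ) (l : List ι) :
    (l.mergeSort (fun i j => decide (key i ≤ key j))).Pairwise (fun i j => key i ≤ key j) := by
  have h := List.pairwise_mergeSort (le := fun i j => decide (key i ≤ key j))
    (fun i j k => by simpa using fun h1 h2 => le_trans h1 h2)
    (fun i j => by simpa using le_total _ _) l
  simpa using h

theorem perm_eq_of_pairwise_key {key : ι → κ} {l m : List ι} (hp : l.Perm m)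
    (hl : l.Pairwise (fun i j => key i ≤ key j)) (hm : m.Pairwise (fun i j => key i ≤ key j))
    (hinj : ∀ i ∈ l, ∀ j ∈ l, key i = key j → i = j) : l = m :=
  List.Perm.eq_of_pairwise
    (fun i j hi hj h1 h2 => hinj i hi j (hp.mem_iff.2 hj) (le_antisymm h1 h2)) hl hm hp

theorem sortedRuns_eq {key : ι → κ} {f : ι → β} {l m : List ι} (hp : m.Perm l)
    (hm : m.Pairwise (fun i j => key i ≤ key j))
    (hinj : ∀ i ∈ l, ∀ j ∈ l, key i = key j → i = j) :
    sortedRuns key f l = runs (m.map f) := by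
  have hs := List.mergeSort_perm l (fun i j => decide (key i ≤ key j))
  rw [sortedRuns, perm_eq_of_pairwise_key (hs.trans hp.symm) (pairwise_mergeSort_key key l) hm
    (fun i hi j hj => hinj i (hs.mem_iff.1 hi) j (hs.mem_iff.1 hj))]

theorem pairwise_lt_of_isChain_ne {γ : Type*} {key : ι → κ} {f : ι → γ} {l : List ι}
    (hl : l.Pairwise (fun i j => key i ≤ key j)) (hc : (l.map f).IsChain (· ≠ ·))
    (hinj : ∀ i ∈ l, ∀ j ∈ l, key i = key j → i = j) : l.Pairwise (fun i j => key i < key j) := by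
  have : IsTrans ι (fun i j => key i < key j) := ⟨fun _ _ _ => lt_trans⟩
  rw [← List.isChain_iff_pairwise]
  induction l with
  | nil => simp
  | cons i l ih =>
    cases l with
    | nil => simp
    | cons j l =>
      simp only [List.map_cons, List.isChain_cons_cons] at hc ⊢
      rw [List.pairwise_cons] at hl
      refine ⟨lt_of_le_of_ne (hl.1 j (by simp)) fun h => hc.1 ?_,
        ih hl.2 (by simpa using hc.2) fun i hi j hj =>
          hinj i (List.mem_cons_of_mem _ hi) j (List.mem_cons_of_mem _ hj)⟩
      rw [hinj i (by simp) j (by simp) h]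

/-- One index per run of `l` gives a list with strictly increasing keys, hence a sublist of `m`,
whose neighbouring labels differ; no such sublist is longer than the number of runs of `m`. The list
`l` may contain repetitions, which lets it be the image of a non-injective map. -/
theorem runs_map_le_of_subset {key : ι → κ} {f : ι → β} {l m : List ι}
    (hl : l.Pairwise (fun i j => key i ≤ key j)) (hm : m.Pairwise (fun i j => key i ≤ key j))
    (hsub : l ⊆ m) (hinj : ∀ i ∈ m, ∀ j ∈ m, key i = key j → i = j) (hnd : m.Nodup) :
    runs (l.map f) ≤ runs (m.map f) := by
  obtain ⟨l', hl', he⟩ := List.sublist_map_iff.1 (List.destutter_sublist (· ≠ ·) (l.map f))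
  have hc : (l'.map f).IsChain (· ≠ ·) := he ▸ List.isChain_destutter _ _
  have hlt := pairwise_lt_of_isChain_ne (hl.sublist hl') hc
    (fun i hi j hj => hinj i (hsub (hl'.subset hi)) j (hsub (hl'.subset hj)))
  have hmlt : m.Pairwise (fun i j => key i < key j) := by
    refine (hm.and hnd).imp_of_mem fun hi hj h =>
      lt_of_le_of_ne h.1 fun he => h.2 (hinj _ hi _ hj he)
  have : Std.Antisymm (fun i j : ι => key i < key j) := ⟨fun _ _ h1 h2 => (lt_asymm h1 h2).elim⟩
  have hsl : l'.Sublist m := by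
    refine List.sublist_of_subperm_of_pairwise ?_ hlt hmlt
    refine List.subperm_of_subset (hlt.imp fun h => ?_) (fun x hx => hsub (hl'.subset hx))
    rintro rfl
    exact lt_irrefl _ h
  rw [runs_eq_length_destutter, he, runs_eq_length_destutter]
  exact hc.length_le_length_destutter_ne (hsl.map f)

/-- A label-preserving weakly monotone map of index lists does not decrease the number of runs. -/
theorem sortedRuns_le_of_monotone {key : ι → κ} {key' : ι' → κ'} {f : ι → β} {f' : ι' → β}
    {l : List ι} {m : List ι'} (φ : ι → ι') (hmem : ∀ i ∈ l, φ i ∈ m)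
    (hmono : ∀ i ∈ l, ∀ j ∈ l, key i ≤ key j → key' (φ i) ≤ key' (φ j))
    (hf : ∀ i ∈ l, f' (φ i) = f i)
    (hinj : ∀ i ∈ m, ∀ j ∈ m, key' i = key' j → i = j) (hnd : m.Nodup) :
    sortedRuns key f l ≤ sortedRuns key' f' m := by
  unfold sortedRuns
  set s := l.mergeSort (fun i j => decide (key i ≤ key j))
  have hs : ∀ i, i ∈ s ↔ i ∈ l := fun i => List.mem_mergeSort
  have h1 : s.map f = (s.map φ).map f' := by
    rw [List.map_map]
    exact List.map_congr_left fun i hi => (hf i ((hs i).1 hi)).symm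
  rw [h1]
  refine runs_map_le_of_subset ?_ (pairwise_mergeSort_key key' m) ?_
    (fun i hi j hj => hinj i (List.mem_mergeSort.1 hi) j (List.mem_mergeSort.1 hj))
    ((List.mergeSort_perm _ _).nodup_iff.2 hnd)
  · rw [List.pairwise_map]
    exact (pairwise_mergeSort_key key l).imp_of_mem fun {i j} hi hj h =>
      hmono i ((hs i).1 hi) j ((hs j).1 hj) h
  · intro x hx
    obtain ⟨i, hi, rfl⟩ := List.mem_map.1 hx
    exact List.mem_mergeSort.2 (hmem i ((hs i).1 hi))

/-- Deleting `s` from a sorted list leaves it sorted, so inserting an index amounts to inserting one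
letter in the word of labels. -/
theorem exists_sortedRuns_cons {key : ι → κ} (f : ι → β) {s : ι} {l : List ι}
    (hinj : ∀ i ∈ s :: l, ∀ j ∈ s :: l, key i = key j → i = j) :
    ∃ u v : List ι, (u ++ v).Perm l ∧
      (u ++ s :: v).Pairwise (fun i j => key i ≤ key j) ∧
      sortedRuns key f (s :: l) = runs (u.map f ++ f s :: v.map f) ∧
      sortedRuns key f l = runs (u.map f ++ v.map f) := by
  have hp := List.mergeSort_perm (s :: l) (fun i j => decide (key i ≤ key j))
  have hs := pairwise_mergeSort_key key (s :: l)
  obtain ⟨u, v, huv⟩ := List.append_of_mem (hp.mem_iff.2 (List.mem_cons_self (a := s) (l := l)))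
  rw [huv] at hp hs
  have hp' : (u ++ v).Perm l := (List.perm_middle.symm.trans hp).cons_inv
  have hs' : (u ++ v).Pairwise (fun i j => key i ≤ key j) :=
    hs.sublist ((List.sublist_cons_self s v).append_left u)
  refine ⟨u, v, hp', hs, ?_, ?_⟩
  · simpa using sortedRuns_eq (f := f) hp hs hinj
  · simpa using sortedRuns_eq (f := f) hp' hs' fun i hi j hj =>
      hinj i (List.mem_cons_of_mem _ hi) j (List.mem_cons_of_mem _ hj)

theorem sortedRuns_cons_le {key : ι → κ} (f : ι → β) {s : ι} {l : List ι}
    (hinj : ∀ i ∈ s :: l, ∀ j ∈ s :: l, key i = key j → i = j) :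
    sortedRuns key f (s :: l) ≤ sortedRuns key f l + 2 := by
  obtain ⟨u, v, -, -, h1, h2⟩ := exists_sortedRuns_cons f hinj
  rw [h1, h2]
  exact runs_append_cons_le _ _ _

theorem sortedRuns_append_le {key : ι → κ} (f : ι → β) {m l : List ι}
    (hinj : ∀ i ∈ m ++ l, ∀ j ∈ m ++ l, key i = key j → i = j) :
    sortedRuns key f (m ++ l) ≤ sortedRuns key f l + 2 * m.length := by
  induction m with
  | nil => simp
  | cons s m ih =>
    have h1 := sortedRuns_cons_le f (s := s) (l := m ++ l) hinj
    have h2 := ih fun i hi j hj =>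
      hinj i (List.mem_cons_of_mem _ hi) j (List.mem_cons_of_mem _ hj)
    simp only [List.cons_append, List.length_cons]
    omega

theorem sortedRuns_cons_between {key : ι → κ} {f : ι → β} {s p q : ι} {l : List ι}
    (hinj : ∀ i ∈ s :: l, ∀ j ∈ s :: l, key i = key j → i = j)
    (hp : p ∈ l) (hq : q ∈ l) (hps : key p < key s) (hsq : key s < key q)
    (hadj : ∀ t ∈ l, key t ≤ key p ∨ key q ≤ key t) (hf : f p ≠ f s) (hfpq : f p = f q) :
    sortedRuns key f (s :: l) = sortedRuns key f l + 2 := by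
  obtain ⟨u, v, hperm, hs, h1, h2⟩ := exists_sortedRuns_cons f hinj
  have hinj' : ∀ i ∈ l, ∀ j ∈ l, key i = key j → i = j := fun i hi j hj =>
    hinj i (List.mem_cons_of_mem _ hi) j (List.mem_cons_of_mem _ hj)
  rw [List.pairwise_append, List.pairwise_cons] at hs
  obtain ⟨hu, ⟨hsv, hv⟩, huv⟩ := hs
  have hpu : p ∈ u := by
    rcases List.mem_append.1 (hperm.mem_iff.2 hp) with h | h
    · exact h
    · exact absurd (hsv p h) (not_le.2 hps)
  have hqv : q ∈ v := by
    rcases List.mem_append.1 (hperm.mem_iff.2 hq) with h | h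
    · exact absurd (huv q h s (by simp)) (not_le.2 hsq)
    · exact h
  obtain ⟨u', p', rfl⟩ : ∃ u' p', u = u' ++ [p'] :=
    ⟨u.dropLast, u.getLast (List.ne_nil_of_mem hpu), (List.dropLast_append_getLast _).symm⟩
  obtain ⟨q', v', rfl⟩ := List.exists_cons_of_ne_nil (List.ne_nil_of_mem hqv)
  -- The neighbours of `s` in the sorted list must be `p` and `q`, since no key of `l` lies strictly
  -- between theirs.
  have hp' : p' = p := by
    have hm : p' ∈ l := hperm.mem_iff.1 (by simp)
    refine hinj' p' hm p hp (le_antisymm ?_ ?_)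
    · refine (hadj p' hm).resolve_right fun h => ?_
      exact absurd (h.trans (huv p' (by simp) s (by simp))) (not_le.2 hsq)
    · rcases List.mem_append.1 hpu with h | h
      · exact (List.pairwise_append.1 hu).2.2 p h p' (by simp)
      · rw [List.mem_singleton.1 h]
  have hq' : q' = q := by
    have hm : q' ∈ l := hperm.mem_iff.1 (by simp)
    refine hinj' q' hm q hq (le_antisymm ?_ ?_)
    · rcases List.mem_cons.1 hqv with h | h
      · rw [h]
      · exact (List.pairwise_cons.1 hv).1 q h
    · refine (hadj q' hm).resolve_left fun h => ?_
      exact absurd ((hsv q' (by simp)).trans h) (not_le.2 hps)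
  subst hp' hq'
  rw [h1, h2]
  simpa [← hfpq] using runs_append_between (u'.map f) (v'.map f) hf

end SortedRuns

/-! ### From rotations of `v$` to suffixes of `v` -/

section Suffixes

variable {α : Type*}

/-- The letter of `w$` that cyclically precedes the position `i`. -/
def label (v : List α) (i : ℕ) : WithBot α :=
  if i = 0 then ⊥ else (v[i - 1]?).elim ⊥ (WithBot.some)

theorem label_succ_of_drop_eq {v u : List α} {i : ℕ} {c : α} (h : v.drop i = c :: u) :
    label v (i + 1) = c := by
  have h2 : v[i]? = some c := by
    have := congrArg (fun l => l[0]?) h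
    simpa using this
  simp [label, h2]

theorem label_append (v x : List α) {i : ℕ} (hi : i ≤ v.length) :
    label (v ++ x) i = label v i := by
  unfold label
  split_ifs with h
  · rfl
  · rw [List.getElem?_append_left (by omega)]

theorem drop_injOn (v : List α) {i j : ℕ} (hi : i ≤ v.length) (hj : j ≤ v.length)
    (h : v.drop i = v.drop j) : i = j := by
  have := congrArg List.length h
  simp only [List.length_drop] at this
  omega

theorem withDollar_eq (v : List α) : withDollar v = v.map WithBot.some ++ [⊥] := by
  simp [withDollar, List.map_eq_flatMap]

theorem rotate_withDollar (v : List α) {i : ℕ} (hi : i ≤ v.length) :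
    (withDollar v).rotate i =
      (v.drop i).map WithBot.some ++ ⊥ :: (v.take i).map WithBot.some := by
  rw [withDollar_eq, List.rotate_eq_drop_append_take (by simp; omega),
    List.drop_append_of_le_length (by simpa), List.take_append_of_le_length (by simpa)]
  simp

variable [LinearOrder α]

theorem map_coe_append_bot_lt {u u' : List α} (h : u < u') (r r' : List (WithBot α)) :
    u.map WithBot.some ++ ⊥ :: r < u'.map WithBot.some ++ ⊥ :: r' := by
  induction u generalizing u' with
  | nil =>
    cases u' with
    | nil => simp at h
    | cons d u' => simp [List.cons_lt_cons_iff]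
  | cons c u ih =>
    cases u' with
    | nil => simp at h
    | cons d u' =>
      simp only [List.map_cons, List.cons_append, List.cons_lt_cons_iff, WithBot.coe_lt_coe,
        WithBot.coe_inj] at h ⊢
      exact h.imp id fun h => ⟨h.1, ih h.2⟩

/-- Two rotations of `v$` are separated no later than the first `$`, which acts as the end of word
in the suffix order. The range has `v.length + 1` entries because the empty suffix, that is the
rotation starting with `$`, takes part. -/
theorem rDollar_eq_sortedRuns (v : List α) :
    rDollar v = sortedRuns (fun i => v.drop i) (label v) (List.range (v.length + 1)) := by
  have hlen : (withDollar v).length = v.length + 1 := by simp [withDollar_eq]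
  have hmem : ∀ i, i ∈ conjArray (withDollar v) → i ≤ v.length := by
    intro i hi
    have := List.mem_range.1 (List.mem_mergeSort.1 hi)
    omega
  have hperm : (conjArray (withDollar v)).Perm (List.range (v.length + 1)) := by
    rw [← hlen]
    exact List.mergeSort_perm _ _
  have hpair : (conjArray (withDollar v)).Pairwise (fun i j => v.drop i ≤ v.drop j) := by
    have h := pairwise_mergeSort_key (fun i => toLex ((withDollar v).rotate i, i))
      (List.range (withDollar v).length)
    refine List.Pairwise.imp_of_mem (fun {i j} hi hj h => ?_) h
    by_contra hlt
    rw [not_le] at hlt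
    refine absurd h (not_le.2 ?_)
    rw [Prod.Lex.toLex_lt_toLex]
    left
    rw [rotate_withDollar v (hmem i hi), rotate_withDollar v (hmem j hj)]
    exact map_coe_append_bot_lt hlt _ _
  rw [sortedRuns_eq hperm hpair, rDollar, bwt]
  · congr 1
    rw [← List.filterMap_eq_map]
    refine List.filterMap_congr fun i hi => ?_
    have hi' := hmem i hi
    simp only [Function.comp, label, withDollar_eq]
    split_ifs with h0
    · simp
    · rw [List.getElem?_append_left (by simp; omega), List.getElem?_map,
        List.getElem?_eq_getElem (by omega)]
      simp
  · intro i hi j hj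
    rw [List.mem_range] at hi hj
    exact drop_injOn v (by omega) (by omega)

end Suffixes

/-! ### Lexicographic comparison of words with common prefixes or powers -/

section Lex

theorem append_lt_append_iff_left {α : Type*} [LinearOrder α] (l u v : List α) :
    l ++ u < l ++ v ↔ u < v := by
  induction l with
  | nil => simp
  | cons c l ih => simpa [List.cons_lt_cons_iff] using ih

theorem append_le_append_iff_left {α : Type*} [LinearOrder α] (l u v : List α) :
    l ++ u ≤ l ++ v ↔ u ≤ v := by
  rw [← not_lt, append_lt_append_iff_left, not_lt]

theorem le_append_right_self {α : Type*} [LinearOrder α] (l u : List α) : l ≤ l ++ u := by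
  simpa using (append_le_append_iff_left l [] u).2 (by simp [← not_lt])

theorem replicate_append_lt {α : Type*} [LinearOrder α] {c d : α} {j m : ℕ} (h : j < m)
    (hcd : d < c) (r r' : List α) :
    List.replicate j c ++ d :: r < List.replicate m c ++ r' := by
  obtain ⟨n, rfl⟩ := Nat.exists_eq_add_of_lt h
  rw [add_assoc, List.replicate_add, List.append_assoc, append_lt_append_iff_left]
  simp [List.replicate_succ, List.cons_lt_cons_iff, hcd]

theorem replicate_append_gt {α : Type*} [LinearOrder α] {c d : α} {j m : ℕ} (h : j < m)
    (hcd : c < d) (r r' : List α) :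
    List.replicate m c ++ r' < List.replicate j c ++ d :: r := by
  obtain ⟨n, rfl⟩ := Nat.exists_eq_add_of_lt h
  rw [add_assoc, List.replicate_add, List.append_assoc, append_lt_append_iff_left]
  simp [List.replicate_succ, List.cons_lt_cons_iff, hcd]

/-- Two words neither of which is a prefix of the other compare in the same way after extension. -/
theorem append_lt_append_of_not_prefix {α : Type*} [LinearOrder α] {u v : List α} (h : u < v)
    (hp : ¬ u <+: v) (r r' : List α) : u ++ r < v ++ r' := by
  induction u generalizing v with
  | nil => simp at hp
  | cons c u ih =>
    cases v with
    | nil => simp at h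
    | cons d v =>
      simp only [List.cons_append, List.cons_lt_cons_iff, List.cons_prefix_cons] at h hp ⊢
      rcases h with h | ⟨rfl, h⟩
      · exact Or.inl h
      · exact Or.inr ⟨rfl, ih h (by simpa using hp)⟩

/-- Every word between `y` and `y z` has the prefix `y`. -/
theorem exists_append_of_between {α : Type*} [LinearOrder α] {y t z : List α} (h1 : y ≤ t)
    (h2 : t < y ++ z) : ∃ u, t = y ++ u ∧ u < z := by
  induction y generalizing t with
  | nil => exact ⟨t, rfl, h2⟩
  | cons c y ih =>
    cases t with
    | nil => simp [← not_lt] at h1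
    | cons d t =>
      rw [← not_lt, List.cons_lt_cons_iff, not_or, not_and, not_lt, not_lt] at h1
      rw [List.cons_append, List.cons_lt_cons_iff] at h2
      rcases h2 with h | ⟨rfl, h⟩
      · exact absurd h (not_lt.2 h1.1)
      · obtain ⟨u, rfl, hu⟩ := ih (h1.2 rfl) h
        exact ⟨u, rfl, hu⟩

end Lex

/-! ### Shape and order of the base suffixes -/

section Tails

/-- The suffix `(∏_{j=i}^{k-1} s_j e_j) q_k x` of `w_k x`. -/
def tailWord (k : ℕ) (x : List Letter) (i : ℕ) : List Letter :=
  (List.range' i (k - i)).flatMap (fun j => s j ++ e j) ++ (q k ++ x)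

/-- The part `a b a^(i-2) ⋯` of `w_k x` that follows the block `b^i` of `e_i`. -/
def tailE (k : ℕ) (x : List Letter) (i : ℕ) : List Letter :=
  [a, b] ++ (List.replicate (i - 2) a ++ tailWord k x (i + 1))

/-- The part `a a a b^i ⋯` of `w_k x` that follows the block `b^i` of `s_i`. -/
def tailS (k : ℕ) (x : List Letter) (i : ℕ) : List Letter :=
  [a, a, a] ++ (List.replicate i b ++ tailE k x i)

variable {k : ℕ} {x : List Letter}

theorem tailWord_two (k : ℕ) (x : List Letter) : tailWord k x 2 = wk k ++ x := by
  simp [tailWord, wk]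

theorem tailWord_self (k : ℕ) (x : List Letter) : tailWord k x k = q k ++ x := by
  simp [tailWord]

theorem tailWord_of_lt {i : ℕ} (hi : i < k) :
    tailWord k x i = (s i ++ e i) ++ tailWord k x (i + 1) := by
  obtain ⟨n, rfl⟩ := Nat.exists_eq_add_of_lt hi
  have h1 : i + n + 1 - i = n + 1 := by omega
  have h2 : i + n + 1 - (i + 1) = n := by omega
  simp only [tailWord, h1, h2, List.range'_succ, List.flatMap_cons, List.append_assoc]

theorem tailWord_eq_tailS {i : ℕ} (hi : i < k) :
    tailWord k x i = a :: (List.replicate i b ++ tailS k x i) := by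
  rw [tailWord_of_lt hi]
  simp [s, e, tailS, tailE]

theorem exists_tailWord_eq {i : ℕ} (h0 : 1 ≤ i) (hi : i ≤ k) :
    ∃ v, tailWord k x i = a :: b :: v := by
  obtain ⟨n, rfl⟩ := Nat.exists_eq_add_of_le' h0
  rcases hi.eq_or_lt with rfl | h
  · exact ⟨_, by rw [tailWord_self, q, List.replicate_succ]; rfl⟩
  · exact ⟨_, by rw [tailWord_eq_tailS h, List.replicate_succ]; rfl⟩

theorem exists_tailE_eq {i : ℕ} (h2 : 2 ≤ i) (hi : i < k) :
    ∃ v, tailE k x i = a :: b :: (List.replicate (i - 1) a ++ b :: v) := by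
  obtain ⟨v, hv⟩ := exists_tailWord_eq (k := k) (x := x) (i := i + 1) (by omega) hi
  refine ⟨v, ?_⟩
  obtain ⟨n, rfl⟩ := Nat.exists_eq_add_of_le' h2
  simp [tailE, hv, List.replicate_succ']

theorem exists_replicate_tailWord_eq {i : ℕ} (h2 : 1 ≤ i) (hi : i ≤ k) (r : ℕ) :
    ∃ v, List.replicate r a ++ tailWord k x i = List.replicate (r + 1) a ++ b :: v := by
  obtain ⟨v, hv⟩ := exists_tailWord_eq (k := k) (x := x) h2 hi
  exact ⟨v, by simp [hv, List.replicate_succ']⟩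

theorem suffix_append_iff' {α : Type*} {u l m : List α} :
    u <:+ l ++ m ↔ u <:+ m ∨ ∃ l', l' <:+ l ∧ l' ≠ [] ∧ u = l' ++ m := by
  induction l with
  | nil =>
    simp only [List.nil_append, List.suffix_nil]
    exact ⟨Or.inl, fun h => h.elim id fun ⟨_, h1, h2, _⟩ => absurd h1 h2⟩
  | cons c l ih =>
    rw [List.cons_append, List.suffix_cons_iff, ih]
    constructor
    · rintro (rfl | h | ⟨l', h1, h2, h3⟩)
      · exact Or.inr ⟨c :: l, List.suffix_refl _, by simp, rfl⟩
      · exact Or.inl h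
      · exact Or.inr ⟨l', h1.trans (List.suffix_cons _ _), h2, h3⟩
    · rintro (h | ⟨l', h1, h2, h3⟩)
      · exact Or.inr (Or.inl h)
      · rcases List.suffix_cons_iff.1 h1 with rfl | h
        · exact Or.inl h3
        · exact Or.inr (Or.inr ⟨l', h, h2, h3⟩)

theorem suffix_replicate_append_iff {α : Type*} {c : α} {u m : List α} {n : ℕ} :
    u <:+ List.replicate n c ++ m ↔
      u <:+ m ∨ ∃ j, 1 ≤ j ∧ j ≤ n ∧ u = List.replicate j c ++ m := by
  rw [suffix_append_iff']
  refine or_congr_right ⟨?_, ?_⟩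
  · rintro ⟨l', h1, h2, h3⟩
    obtain ⟨h4, h5⟩ := List.suffix_replicate_iff.1 h1
    exact ⟨l'.length, List.length_pos_iff.2 h2, h4, by rw [h3, ← h5]⟩
  · rintro ⟨j, h1, h2, h3⟩
    exact ⟨List.replicate j c, List.suffix_replicate_iff.2 (by simpa using h2),
      by simp; omega, h3⟩

/-- The form of the suffixes of `w_k x` that start at or before the last block `a b^k`. -/
inductive IsBaseSuffix (k : ℕ) (x : List Letter) : List Letter → Prop
  | start_a (r : ℕ) (v : List Letter) (h1 : 1 ≤ r) (h2 : r < k - 2) :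
      IsBaseSuffix k x (List.replicate r a ++ b :: v)
  | least : IsBaseSuffix k x (List.replicate (k - 3) a ++ tailWord k x k)
  | block_s (i j : ℕ) (h2 : 2 ≤ i) (hi : i < k) (h1 : 1 ≤ j) (hj : j ≤ i) :
      IsBaseSuffix k x (List.replicate j b ++ tailS k x i)
  | block_e (i j : ℕ) (h2 : 2 ≤ i) (hi : i < k) (h1 : 1 ≤ j) (hj : j ≤ i) :
      IsBaseSuffix k x (List.replicate j b ++ tailE k x i)
  | last_b (v : List Letter) : IsBaseSuffix k x (b :: a :: v)

theorem isBaseSuffix_replicate (hk : 5 < k) {i r : ℕ} (h2 : 2 ≤ i) (hi : i < k) (hr : r ≤ i - 2) :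
    IsBaseSuffix k x (List.replicate r a ++ tailWord k x (i + 1)) := by
  by_cases h : i = k - 1 ∧ r = k - 3
  · rw [h.2, h.1, show k - 1 + 1 = k by omega]
    exact .least
  · obtain ⟨v, hv⟩ := exists_replicate_tailWord_eq (k := k) (x := x) (i := i + 1) (by omega) hi r
    rw [hv]
    exact .start_a _ _ (by omega) (by omega)

theorem isBaseSuffix_of_suffix_tailWord (hk : 5 < k) {i : ℕ} (h2 : 2 ≤ i) (hi : i ≤ k)
    {u : List Letter} (hu : u <:+ tailWord k x i) (hlen : (q k ++ x).length ≤ u.length) :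
    IsBaseSuffix k x u := by
  revert u
  refine Nat.decreasingInduction' (P := fun i => ∀ {u : List Letter}, u <:+ tailWord k x i →
    (q k ++ x).length ≤ u.length → IsBaseSuffix k x u) ?_ hi ?_
  · intro i hik h2i ih u hu hlen
    have hi2 : 2 ≤ i := by omega
    have hb : ∃ n, i = n + 1 := ⟨i - 1, by omega⟩
    have hw : tailWord k x i = [a] ++ (List.replicate i b ++ ([a, a, a] ++
        (List.replicate i b ++ ([a, b] ++ (List.replicate (i - 2) a ++ tailWord k x (i + 1)))))) := by
      rw [tailWord_eq_tailS hik]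
      simp [tailS, tailE]
    have hbi : ∀ v, ∃ v', List.replicate i b ++ v = b :: v' := fun v => by
      obtain ⟨n, hn⟩ := hb
      exact ⟨List.replicate n b ++ v, by rw [hn, List.replicate_succ]; rfl⟩
    rw [hw, List.singleton_append, List.suffix_cons_iff, suffix_replicate_append_iff] at hu
    rcases hu with rfl | hu | ⟨j, hj1, hj2, rfl⟩
    · obtain ⟨v, hv⟩ := hbi _
      rw [hv]
      exact .start_a 1 v le_rfl (by omega)
    · obtain ⟨v, hv⟩ := hbi ([a, b] ++ (List.replicate (i - 2) a ++ tailWord k x (i + 1)))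
      -- The block `aaa` inside `s_i e_i` must be shorter than the run `a^(k-2)` that starts
      -- `least`; `3 < k - 2` is where `k > 5` is needed.
      have h3 : ∀ r, 1 ≤ r → r ≤ 3 → IsBaseSuffix k x (List.replicate r a ++ b :: v) :=
        fun r h1 h3 => .start_a r v h1 (by omega)
      simp only [List.cons_append, List.nil_append, List.suffix_cons_iff,
        suffix_replicate_append_iff] at hu hv
      rcases hu with rfl | rfl | rfl | (rfl | rfl | hu | ⟨j, hj1, hj2, rfl⟩) | ⟨j, hj1, hj2, rfl⟩
      · rw [hv]; exact h3 3 (by omega) (by omega)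
      · rw [hv]; exact h3 2 (by omega) (by omega)
      · rw [hv]; exact h3 1 (by omega) (by omega)
      · exact .start_a 1 _ le_rfl (by omega)
      · obtain ⟨v, hv⟩ := exists_replicate_tailWord_eq (k := k) (x := x) (i := i + 1)
          (by omega) hik (i - 2)
        rw [hv, List.replicate_succ]
        exact .last_b _
      · exact ih hu hlen
      · exact isBaseSuffix_replicate hk hi2 hik hj2
      · exact .block_e i j hi2 hik hj1 hj2
    · exact .block_s i j hi2 hik hj1 hj2
  · intro u hu hlen
    rw [tailWord_self] at hu
    rw [hu.eq_of_length_le hlen]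
    obtain ⟨v, hv⟩ := exists_tailWord_eq (k := k) (x := x) (i := k) (by omega) le_rfl
    rw [← tailWord_self, hv]
    exact .start_a 1 v le_rfl (by omega)

theorem isBaseSuffix_of_suffix (hk : 5 < k) {u : List Letter} (hu : u <:+ wk k ++ x)
    (hlen : k + 2 + x.length ≤ u.length) : IsBaseSuffix k x u := by
  rw [← tailWord_two] at hu
  exact isBaseSuffix_of_suffix_tailWord hk le_rfl (by omega) hu (by simp [q]; omega)

theorem IsBaseSuffix.lt_replicate {u : List Letter} (hk : 5 < k) (hu : IsBaseSuffix k x u)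
    (r : List Letter) : u < List.replicate k b ++ r := by
  have hab : a < b := by decide
  have key : ∀ j v, j < k → List.replicate j b ++ a :: v < List.replicate k b ++ r :=
    fun j v hj => replicate_append_lt hj hab v r
  cases hu with
  | start_a n v h1 h2 =>
    obtain ⟨n, rfl⟩ := Nat.exists_eq_add_of_le' h1
    exact key 0 _ (by omega)
  | least =>
    obtain ⟨n, hn⟩ : ∃ n, k - 3 = n + 1 := ⟨k - 4, by omega⟩
    rw [hn]
    exact key 0 _ (by omega)
  | block_s i j h2 hi h1 hj => exact key j _ (by omega)
  | block_e i j h2 hi h1 hj => exact key j _ (by omega)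
  | last_b v => exact key 1 _ (by omega)

/-- Two consecutive base suffixes. -/
theorem IsBaseSuffix.le_or_le {u : List Letter} (hk : 5 < k) (hu : IsBaseSuffix k x u) {m : ℕ}
    (hm2 : 2 ≤ m) (hmk : m + 1 < k) :
    u ≤ List.replicate m b ++ tailE k x m ∨ List.replicate (m + 1) b ++ tailS k x (m + 1) ≤ u := by
  have hab : a < b := by decide
  have low : ∀ j v, j < m → List.replicate j b ++ a :: v < List.replicate m b ++ tailE k x m :=
    fun j v hj => replicate_append_lt hj hab v _
  have high : ∀ j v, m + 1 < j →
      List.replicate (m + 1) b ++ tailS k x (m + 1) < List.replicate j b ++ v :=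
    fun j v hj => replicate_append_lt hj hab _ v
  cases hu with
  | start_a n v h1 h2 =>
    obtain ⟨n, rfl⟩ := Nat.exists_eq_add_of_le' h1
    exact .inl (low 0 _ (by omega)).le
  | least =>
    obtain ⟨n, hn⟩ : ∃ n, k - 3 = n + 1 := ⟨k - 4, by omega⟩
    rw [hn]
    exact .inl (low 0 _ (by omega)).le
  | block_s i j h2 hi h1 hj =>
    rcases lt_trichotomy j (m + 1) with h | rfl | h
    -- After equally many `b`s, every `tailS` (starting with `aaa`) precedes every `tailE` (starting
    -- with `ab`). The `tailS_i` increase with `i`, and the `tailE_i = ab a^(i-1) b ⋯` decrease.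
    -- Hence `tailE_m` is the largest continuation of `b^m`, and `tailS_(m+1)` the smallest of
    -- `b^(m+1)`.
    · rcases (Nat.lt_succ_iff.1 h).lt_or_eq with h | rfl
      · exact .inl (low _ _ h).le
      · left
        rw [append_le_append_iff_left]
        refine le_of_lt ?_
        simp [tailS, tailE, List.cons_lt_cons_iff]
    · right
      rw [append_le_append_iff_left]
      rcases hj.eq_or_lt with rfl | h
      · exact le_rfl
      · rw [tailS, tailS, append_le_append_iff_left]
        exact (replicate_append_lt h hab _ _).le
    · exact .inr (high _ _ h).le
  | block_e i j h2 hi h1 hj =>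
    rcases lt_trichotomy j (m + 1) with h | rfl | h
    · rcases (Nat.lt_succ_iff.1 h).lt_or_eq with h | rfl
      · exact .inl (low _ _ h).le
      · left
        rw [append_le_append_iff_left]
        rcases hj.eq_or_lt with rfl | h
        · exact le_rfl
        · obtain ⟨v, hv⟩ := exists_tailE_eq (x := x) h2 hi
          obtain ⟨v', hv'⟩ := exists_tailE_eq (x := x) hm2 (show j < k by omega)
          rw [hv, hv']
          have := replicate_append_gt (show j - 1 < i - 1 by omega) hab v' (b :: v)
          exact (append_le_append_iff_left [a, b] _ _).2 this.le
    · right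
      rw [append_le_append_iff_left]
      refine le_of_lt ?_
      simp [tailS, tailE, List.cons_lt_cons_iff]
    · exact .inr (high _ _ h).le
  | last_b v => exact .inl (low 1 _ (by omega)).le

/-- The end of `e_(k-1)` and the first letter of `q_k` form `a^(k-2)`, a longer initial run of `a`
than in any other base suffix. -/
theorem IsBaseSuffix.least_le {u : List Letter} (hk : 5 < k) (hu : IsBaseSuffix k x u) :
    List.replicate (k - 3) a ++ tailWord k x k ≤ u := by
  have hab : a < b := by decide
  obtain ⟨v0, hv0⟩ := exists_replicate_tailWord_eq (k := k) (x := x) (i := k) (by omega) le_rfl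
    (k - 3)
  cases hu with
  | start_a n v h1 h2 =>
    rw [hv0]
    exact (replicate_append_gt (by omega) hab _ _).le
  | least => exact le_rfl
  | block_s i j h2 hi h1 hj =>
    obtain ⟨j, rfl⟩ := Nat.exists_eq_add_of_le' h1
    rw [hv0]
    exact (replicate_append_gt (j := 0) (by omega) hab _ _).le
  | block_e i j h2 hi h1 hj =>
    obtain ⟨j, rfl⟩ := Nat.exists_eq_add_of_le' h1
    rw [hv0]
    exact (replicate_append_gt (j := 0) (by omega) hab _ _).le
  | last_b v =>
    rw [hv0]
    exact (replicate_append_gt (j := 0) (by omega) hab _ _).le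

end Tails

/-! ### Positions of suffixes and of factors -/

section Positions

variable {α : Type*}

theorem exists_position {v u : List α} {c : α} (h : c :: u <:+ v) :
    ∃ i, i + u.length = v.length ∧ v.drop i = u ∧ label v i = c := by
  obtain ⟨w, rfl⟩ := h
  refine ⟨w.length + 1, by simp; omega, by simp [List.drop_append], ?_⟩
  exact label_succ_of_drop_eq (u := u) (by simp)

theorem label_append_append (u v w : List α) {r : ℕ} (h1 : 1 ≤ r) (hr : r ≤ v.length) :
    label (u ++ (v ++ w)) (u.length + r) = label v r := by
  obtain ⟨r, rfl⟩ := Nat.exists_eq_add_of_le' h1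
  simp only [label, ← add_assoc, Nat.add_sub_cancel, Nat.add_eq_zero_iff, one_ne_zero, and_false,
    if_false]
  rw [List.getElem?_append_right (by omega), List.getElem?_append_left (by omega)]
  simp

theorem drop_length_add_append (u v w : List α) {r : ℕ} (hr : r ≤ v.length) :
    (u ++ (v ++ w)).drop (u.length + r) = v.drop r ++ w := by
  rw [← List.drop_drop, List.drop_left, List.drop_append_of_le_length hr]

end Positions

/-! ### Base runs, and the extra runs when `x` is `bb`, empty or `a` -/

section Base

/-- The position of the last block `a b^k` in `w_k`. -/
def lastBlock (k : ℕ) : ℕ :=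
  ((List.range' 2 (k - 2)).flatMap (fun i => s i ++ e i)).length

/-- The number of runs of the letters preceding the positions up to the last block of `w_k x`, in
the order of the suffixes that start there. -/
def baseRuns (k : ℕ) (x : List Letter) : ℕ :=
  sortedRuns (fun i => (wk k ++ x).drop i) (label (wk k ++ x)) (List.range (lastBlock k + 1))

variable {k : ℕ}

theorem length_wk (k : ℕ) : (wk k).length = lastBlock k + (k + 2) := by
  simp [wk, lastBlock, q]

theorem length_wk_append (k : ℕ) (x : List Letter) :
    (wk k ++ x).length = lastBlock k + (k + 2) + x.length := by
  rw [List.length_append, length_wk]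

theorem isBaseSuffix_drop (hk : 5 < k) (x : List Letter) {i : ℕ} (hi : i ≤ lastBlock k) :
    IsBaseSuffix k x ((wk k ++ x).drop i) := by
  refine isBaseSuffix_of_suffix hk (List.drop_suffix _ _) ?_
  rw [List.length_drop, length_wk_append]
  omega

/-- The truncated suffixes end in `b^k`; a prefix relation would produce a base suffix that starts
with `b^k`, against `IsBaseSuffix.lt_replicate`. -/
theorem not_prefix_of_ne (hk : 5 < k) {i j : ℕ} (hi : i ≤ lastBlock k) (hj : j ≤ lastBlock k)
    (hij : i ≠ j) : ¬ (wk k).dropLast.drop i <+: (wk k).dropLast.drop j := by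
  rintro ⟨r, hr⟩
  obtain ⟨W, hW, hlen⟩ : ∃ W : List Letter, (wk k).dropLast = W ++ List.replicate k b ∧
      W.length = lastBlock k + 1 := by
    refine ⟨(List.range' 2 (k - 2)).flatMap (fun i => s i ++ e i) ++ [a], ?_, by simp [lastBlock]⟩
    have : wk k = (List.range' 2 (k - 2)).flatMap (fun i => s i ++ e i) ++ [a] ++
        List.replicate k b ++ [a] := by simp [wk, q]
    rw [this, List.dropLast_concat]
  have hwk : wk k = W ++ List.replicate k b ++ [a] := by
    rw [← hW, ← List.dropLast_append_getLast (l := wk k) (by simp [wk, q])]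
    simp [wk, q]
  have hr' := hr
  rw [hW, List.drop_append_of_le_length (by omega), List.append_assoc] at hr
  have hlr := congrArg List.length hr
  rw [List.drop_append_of_le_length (by omega)] at hlr
  simp only [List.length_append, List.length_drop, List.length_replicate] at hlr
  have h1 : (wk k).drop (j + (W.drop i).length) = List.replicate k b ++ (r ++ [a]) := by
    rw [← List.drop_drop, hwk, List.drop_append_of_le_length (by simp; omega), ← hr,
      List.append_assoc, List.drop_left, List.append_assoc]
  have h2 := isBaseSuffix_drop hk [] (i := j + (W.drop i).length) (by simp; omega)
  rw [List.append_nil, h1] at h2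
  exact lt_irrefl _ (h2.lt_replicate hk (r ++ [a]))

theorem drop_le_drop_of_le (hk : 5 < k) (x x' : List Letter) {i j : ℕ} (hi : i ≤ lastBlock k)
    (hj : j ≤ lastBlock k) (h : (wk k ++ x).drop i ≤ (wk k ++ x).drop j) :
    (wk k ++ x').drop i ≤ (wk k ++ x').drop j := by
  rcases eq_or_ne i j with rfl | hij
  · exact le_rfl
  have hne : wk k ≠ [] := by simp [wk, q]
  have hlen : (wk k).dropLast.length = lastBlock k + (k + 1) := by
    rw [List.length_dropLast, length_wk]; rfl
  have hsplit : ∀ (y : List Letter) {t : ℕ}, t ≤ lastBlock k → (wk k ++ y).drop t =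
      (wk k).dropLast.drop t ++ ([(wk k).getLast hne] ++ y) := by
    intro y t ht
    conv_lhs => rw [← List.dropLast_append_getLast hne, List.append_assoc]
    rw [List.drop_append_of_le_length (by omega)]
  rw [hsplit x hi, hsplit x hj] at h
  rw [hsplit x' hi, hsplit x' hj]
  rcases lt_trichotomy ((wk k).dropLast.drop i) ((wk k).dropLast.drop j) with hlt | heq | hgt
  · exact (append_lt_append_of_not_prefix hlt (not_prefix_of_ne hk hi hj hij) _ _).le
  · exact absurd (heq ▸ List.prefix_refl _) (not_prefix_of_ne hk hi hj hij)
  · exact absurd h (not_le.2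
      (append_lt_append_of_not_prefix hgt (not_prefix_of_ne hk hj hi hij.symm) _ _))

theorem baseRuns_le (hk : 5 < k) (x x' : List Letter) : baseRuns k x ≤ baseRuns k x' := by
  refine sortedRuns_le_of_monotone id (fun i hi => hi) ?_ ?_ ?_ List.nodup_range
  · intro i hi j hj
    rw [List.mem_range, Nat.lt_succ_iff] at hi hj
    exact drop_le_drop_of_le hk x x' hi hj
  · intro i hi
    rw [List.mem_range, Nat.lt_succ_iff] at hi
    have : i ≤ (wk k).length := by rw [length_wk]; omega
    rw [id, label_append _ _ this, label_append _ _ this]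
  · intro i hi j hj
    rw [List.mem_range] at hi hj
    exact drop_injOn _ (by rw [length_wk_append]; omega) (by rw [length_wk_append]; omega)

theorem baseRuns_eq (hk : 5 < k) (x x' : List Letter) : baseRuns k x = baseRuns k x' :=
  le_antisymm (baseRuns_le hk x x') (baseRuns_le hk x' x)

theorem sortedRuns_mono {α β : Type*} [LinearOrder α] [LinearOrder β] (v : List α) (f : ℕ → β)
    {l m : List ℕ} (h : l ⊆ m) (hm : ∀ i ∈ m, i ≤ v.length) (hnd : m.Nodup) :
    sortedRuns (fun i => v.drop i) f l ≤ sortedRuns (fun i => v.drop i) f m :=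
  sortedRuns_le_of_monotone id (fun _ hi => h hi) (fun _ _ _ _ h => h) (fun _ _ => rfl)
    (fun i hi j hj => drop_injOn v (hm i hi) (hm j hj)) hnd

theorem baseRuns_le_rDollar (k : ℕ) (x : List Letter) : baseRuns k x ≤ rDollar (wk k ++ x) := by
  rw [rDollar_eq_sortedRuns]
  refine sortedRuns_mono _ _ (fun i hi => ?_) (fun i hi => ?_) List.nodup_range
  · rw [List.mem_range] at hi ⊢
    rw [length_wk_append]
    omega
  · rw [List.mem_range] at hi
    omega

theorem rDollar_le (k : ℕ) (x : List Letter) :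
    rDollar (wk k ++ x) ≤ baseRuns k x + 2 * (k + 2 + x.length) := by
  have hperm : (List.range' (lastBlock k + 1) (k + 2 + x.length) ++
      List.range (lastBlock k + 1)).Perm (List.range ((wk k ++ x).length + 1)) := by
    refine List.perm_append_comm.trans (List.Perm.of_eq ?_)
    rw [List.range_eq_range', List.range_eq_range', length_wk_append]
    have := List.range'_append_1 (s := 0) (m := lastBlock k + 1) (n := k + 2 + x.length)
    rw [zero_add] at this
    rw [this]
    congr 1
    omega
  have hle : ∀ i ∈ List.range' (lastBlock k + 1) (k + 2 + x.length) ++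
      List.range (lastBlock k + 1), i ≤ (wk k ++ x).length := fun i hi => by
    have := List.mem_range.1 (hperm.mem_iff.1 hi)
    omega
  rw [rDollar_eq_sortedRuns]
  refine (sortedRuns_mono _ _ (fun i hi => hperm.mem_iff.2 hi) hle
    (hperm.nodup_iff.2 List.nodup_range)).trans ?_
  refine (sortedRuns_append_le _ fun i hi j hj => drop_injOn _ (hle i hi) (hle j hj)).trans ?_
  rw [baseRuns, List.length_range']

theorem tailWord_suffix (k : ℕ) (x : List Letter) {i : ℕ} (h2 : 2 ≤ i) (hi : i ≤ k) :
    tailWord k x i <:+ wk k ++ x := by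
  induction i, h2 using Nat.le_induction with
  | base => rw [tailWord_two]
  | succ i h2 ih =>
    refine List.IsSuffix.trans ?_ (ih (by omega))
    rw [tailWord_of_lt (i := i) (by omega)]
    exact List.suffix_append _ _

theorem replicate_tailS_suffix (k : ℕ) (x : List Letter) {i : ℕ} (h2 : 2 ≤ i) (hi : i < k) :
    a :: (List.replicate i b ++ tailS k x i) <:+ wk k ++ x := by
  rw [← tailWord_eq_tailS hi]
  exact tailWord_suffix k x h2 hi.le

theorem replicate_tailE_suffix (k : ℕ) (x : List Letter) {i : ℕ} (h2 : 2 ≤ i) (hi : i < k) :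
    a :: (List.replicate i b ++ tailE k x i) <:+ wk k ++ x := by
  refine List.IsSuffix.trans ⟨a :: (List.replicate i b ++ [a, a]), ?_⟩
    (replicate_tailS_suffix k x h2 hi)
  simp [tailS]

theorem le_length_tailE (k : ℕ) (x : List Letter) (i : ℕ) :
    k + 2 + x.length ≤ (tailE k x i).length := by
  have : ∀ j, k + 2 + x.length ≤ (tailWord k x j).length := fun j => by
    simp [tailWord, q]
    omega
  have := this (i + 1)
  simp only [tailE, List.length_append]
  omega

theorem replicate_tailS_le_replicate_tailE (k : ℕ) (x : List Letter) {m n : ℕ} (h : m < n) :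
    List.replicate (m + 1) b ++ tailS k x (m + 1) ≤ List.replicate n b ++ tailE k x n := by
  rcases (Nat.succ_le_of_lt h).lt_or_eq with h | rfl
  · exact (replicate_append_lt h (by decide) _ _).le
  · rw [append_le_append_iff_left]
    refine le_of_lt ?_
    simp [tailS, tailE, List.cons_lt_cons_iff]

/-- Suffixes of `w_k x` that start in the last block, are preceded by `b`, and separate consecutive
base suffixes preceded by `a`, contribute two runs each. -/
theorem le_rDollar_of_between (hk : 5 < k) (x : List Letter) (σ : ℕ → List Letter)
    (hσ : ∀ m, 2 ≤ m → m + 1 < k → b :: σ m <:+ wk k ++ x ∧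
      List.replicate m b ++ tailE k x m < σ m ∧
      σ m < List.replicate (m + 1) b ++ tailS k x (m + 1)) :
    baseRuns k x + 2 * (k - 3) ≤ rDollar (wk k ++ x) := by
  set v := wk k ++ x with hv
  have hlen : v.length = lastBlock k + (k + 2) + x.length := length_wk_append k x
  -- The suffixes `σ 2, σ 3, …` are inserted one at a time. Those already inserted lie below the
  -- next gap, so its two ends are still adjacent.
  have main : ∀ n ≤ k - 3, ∃ l : List ℕ, List.range (lastBlock k + 1) ⊆ l ∧
      (∀ t ∈ l, t ≤ v.length ∧ (t ≤ lastBlock k ∨ ∃ m < n, v.drop t = σ (m + 2))) ∧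
      sortedRuns (fun i => v.drop i) (label v) l = baseRuns k x + 2 * n := by
    intro n
    induction n with
    | zero =>
      refine fun _ => ⟨List.range (lastBlock k + 1), fun _ h => h, fun t ht => ?_, rfl⟩
      rw [List.mem_range] at ht
      exact ⟨by omega, .inl (by omega)⟩
    | succ n ih =>
      intro hn
      obtain ⟨l, hsub, hmem, hR⟩ := ih (by omega)
      obtain ⟨h1, h2, h3⟩ := hσ (n + 2) (by omega) (by omega)
      obtain ⟨i, hil, hi, hfi⟩ := exists_position h1
      obtain ⟨p, hpl, hp, hfp⟩ := exists_position
        (replicate_tailE_suffix k x (i := n + 2) (by omega) (by omega))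
      obtain ⟨t, htl, ht, hft⟩ := exists_position
        (replicate_tailS_suffix k x (i := n + 2 + 1) (by omega) (by omega))
      rw [← hv] at hpl hp hfp htl ht hft
      have hpN : p ≤ lastBlock k := by
        have := le_length_tailE k x (n + 2)
        rw [List.length_append] at hpl
        omega
      have htN : t ≤ lastBlock k := by
        have := le_length_tailE k x (n + 2 + 1)
        simp only [List.length_append, tailS] at htl
        omega
      have hmem' : ∀ j ∈ i :: l, j ≤ v.length := by
        intro j hj
        rcases List.mem_cons.1 hj with rfl | hj
        · omega
        · exact (hmem j hj).1
      refine ⟨i :: l, fun j hj => List.mem_cons_of_mem _ (hsub hj), fun j hj => ?_, ?_⟩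
      · refine ⟨hmem' j hj, ?_⟩
        rcases List.mem_cons.1 hj with rfl | hj
        · exact .inr ⟨n, by omega, hi⟩
        · exact (hmem j hj).2.imp id fun ⟨m, hm, h⟩ => ⟨m, by omega, h⟩
      · rw [sortedRuns_cons_between (p := p) (q := t)
          (fun i hi j hj => drop_injOn v (hmem' i hi) (hmem' j hj))
          (hsub (List.mem_range.2 (by omega))) (hsub (List.mem_range.2 (by omega)))
          (by rwa [hp, hi]) (by rwa [hi, ht]) ?_ ?_ ?_, hR]
        · ring
        · intro j hj
          rw [hp, ht]
          rcases (hmem j hj).2 with hj | ⟨m, hm, hj⟩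
          · exact (isBaseSuffix_drop hk x hj).le_or_le hk (by omega) (by omega)
          · left
            rw [hj]
            exact (hσ (m + 2) (by omega) (by omega)).2.2.le.trans
              (replicate_tailS_le_replicate_tailE k x (by omega))
        · rw [hfp, hfi]
          decide
        · rw [hfp, hft]
  obtain ⟨l, -, hmem, hR⟩ := main (k - 3) le_rfl
  rw [← hR, rDollar_eq_sortedRuns]
  refine sortedRuns_mono _ _ (fun i hi => ?_) (fun i hi => ?_) List.nodup_range
  · have := (hmem i hi).1
    exact List.mem_range.2 (by omega)
  · rw [List.mem_range] at hi
    omega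

theorem wk_eq (k : ℕ) : ∃ W, wk k = W ++ (List.replicate k b ++ [a]) :=
  ⟨(List.range' 2 (k - 2)).flatMap (fun i => s i ++ e i) ++ [a], by simp [wk, q]⟩

theorem cons_replicate_suffix {m : ℕ} (hm : m < k) (x : List Letter) :
    b :: (List.replicate m b ++ a :: x) <:+ wk k ++ x := by
  obtain ⟨W, hW⟩ := wk_eq k
  obtain ⟨n, rfl⟩ := Nat.exists_eq_add_of_lt hm
  refine ⟨W ++ List.replicate n b, ?_⟩
  rw [hW, show m + n + 1 = n + (m + 1) by ring, List.replicate_add, List.replicate_succ]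
  simp

theorem le_rDollar_replicate_a (hk : 5 < k) {r : ℕ} (hr : r ≤ 1) :
    baseRuns k (List.replicate r a) + 2 * (k - 3) ≤ rDollar (wk k ++ List.replicate r a) := by
  -- With `r ≤ 1`, the word `a a^r` is a proper prefix of `tailS_(m+1) = aaa ⋯`: the new suffix lies
  -- just below the upper end of the gap.
  refine le_rDollar_of_between hk _ (fun m => List.replicate (m + 1) b ++ a :: List.replicate r a)
    fun m h2 hm => ⟨cons_replicate_suffix (by omega) _, ?_, ?_⟩
  · exact replicate_append_lt (by omega) (by decide) _ _
  · rw [append_lt_append_iff_left]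
    interval_cases r <;> simp [tailS]

theorem le_rDollar_bb (hk : 5 < k) :
    baseRuns k [b, b] + 2 * (k - 3) ≤ rDollar (wk k ++ [b, b]) := by
  -- Here `abb` exceeds `tailE_m = aba ⋯`, so the new suffix passes the lower end of the gap.
  refine le_rDollar_of_between hk _ (fun m => List.replicate m b ++ a :: [b, b])
    fun m h2 hm => ⟨cons_replicate_suffix (by omega) _, ?_, ?_⟩
  · rw [append_lt_append_iff_left]
    obtain ⟨v, hv⟩ := exists_tailE_eq (x := [b, b]) h2 (show m < k by omega)
    obtain ⟨n, rfl⟩ := Nat.exists_eq_add_of_le' h2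
    simp [hv, List.replicate_succ, List.cons_lt_cons_iff]
  · exact replicate_append_lt (by omega) (by decide) _ _

end Base

/-! ### No more than four extra runs when `x = b` -/

section AppendB

variable {k : ℕ}

theorem least_le_of_suffix (hk : 5 < k) {u : List Letter} (hu : u <:+ wk k ++ [b]) (h0 : u ≠ []) :
    List.replicate (k - 3) a ++ tailWord k [b] k ≤ u := by
  have hab : a < b := by decide
  rcases le_or_gt (k + 3) u.length with hlen | hlen
  · exact (isBaseSuffix_of_suffix hk hu hlen).least_le hk
  obtain ⟨v, hv⟩ := exists_replicate_tailWord_eq (k := k) (x := [b]) (i := k) (by omega) le_rfl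
    (k - 3)
  obtain ⟨W, hW⟩ := wk_eq k
  have hsuf : u <:+ List.replicate k b ++ [a, b] := by
    refine List.suffix_of_suffix_length_le hu ⟨W, by simp [hW]⟩ ?_
    simp
    omega
  have hb : ∀ w, List.replicate (k - 3 + 1) a ++ b :: v ≤ b :: w := fun w =>
    (replicate_append_gt (j := 0) (by omega) hab _ _).le
  rw [hv]
  rw [suffix_replicate_append_iff] at hsuf
  simp only [List.suffix_cons_iff, List.suffix_nil, h0, or_false] at hsuf
  rcases hsuf with (rfl | rfl) | ⟨j, h1, -, rfl⟩
  · exact (replicate_append_gt (j := 1) (by omega) hab _ _).le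
  · exact hb _
  · obtain ⟨j, rfl⟩ := Nat.exists_eq_add_of_le' h1
    exact hb _

/-- A word `t` with `y ≤ t < y z`, where `z` is the least non-empty suffix, would be `y u` with `u <
z`; but `u` is itself a non-empty suffix because `t` is longer than `y`. -/
theorem append_least_le (hk : 5 < k) {y t : List Letter} (ht : t <:+ wk k ++ [b])
    (hlen : y.length < t.length) (h : y ≤ t) :
    y ++ (List.replicate (k - 3) a ++ tailWord k [b] k) ≤ t := by
  by_contra hlt
  obtain ⟨u, rfl, hu⟩ := exists_append_of_between h (not_le.1 hlt)
  refine absurd hu (not_lt.2 (least_le_of_suffix hk ((List.suffix_append y u).trans ht) ?_))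
  rintro rfl
  simp at hlen

/-- The positions of the last `b^(k-1) a b` in `w_k b` inherit the runs of those of the
`b^(k-1) a b` in `e_(k-1)`. -/
theorem rDollar_append_b_le (hk : 5 < k) : rDollar (wk k ++ [b]) ≤ baseRuns k [b] + 4 := by
  set v := wk k ++ [b] with hv
  set Y := List.replicate (k - 1) b ++ [a, b] with hY
  set z := List.replicate (k - 3) a ++ tailWord k [b] k with hz
  set N := lastBlock k with hN
  have hlen : v.length = N + (k + 3) := length_wk_append k [b]
  have hYl : Y.length = k + 1 := by simp [hY]; omega
  have hzl : z.length = 2 * k := by simp [hz, tailWord_self, q]; omega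
  obtain ⟨A, hA⟩ : ∃ A, A ++ (Y ++ z) = v := by
    obtain ⟨A, hA⟩ := replicate_tailE_suffix k [b] (i := k - 1) (by omega) (by omega)
    refine ⟨A ++ [a], ?_⟩
    rw [← hv] at hA
    rw [← hA, hY, hz, tailE, show k - 1 - 2 = k - 3 by omega, show k - 1 + 1 = k by omega]
    simp
  obtain ⟨B, hB⟩ : ∃ B, B ++ Y = v := by
    obtain ⟨W, hW⟩ := wk_eq k
    refine ⟨W ++ [b], ?_⟩
    have : List.replicate k b = b :: List.replicate (k - 1) b := by
      rw [← List.replicate_succ, show k - 1 + 1 = k by omega]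
    rw [hv, hW, hY, this]
    simp
  have hAl : A.length + 2 * k = N + 2 := by
    have := congrArg List.length hA
    simp only [List.length_append, hYl, hzl, hlen] at this
    omega
  have hBl : B.length = N + 2 := by
    have := congrArg List.length hB
    simp only [List.length_append, hYl, hlen] at this
    omega
  -- The two occurrences of `Y` end `|z| = 2k` letters apart. The start `N + 2` of the last one is
  -- left out: it is preceded by `b`, the earlier occurrence by `a`.
  have hdrop : ∀ i, N + 2 < i → i ≤ N + (k + 3) →
      v.drop (i - 2 * k) = v.drop i ++ z ∧ label v (i - 2 * k) = label v i := by
    intro i h1 h2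
    obtain ⟨r, rfl⟩ := Nat.exists_eq_add_of_le h1.le
    have e1 : N + 2 + r - 2 * k = A.length + r := by omega
    rw [e1, ← hBl]
    have h3 := drop_length_add_append A Y z (r := r) (by omega)
    have h4 := drop_length_add_append B Y [] (r := r) (by omega)
    have h5 := label_append_append A Y z (r := r) (by omega) (by omega)
    have h6 := label_append_append B Y [] (r := r) (by omega) (by omega)
    rw [hA] at h3 h5
    rw [List.append_nil, List.append_nil, hB] at h4
    rw [List.append_nil, hB] at h6
    exact ⟨by rw [h3, h4], by rw [h5, h6]⟩
  -- The suffix at `N + 1` starts with `b^k`, so it has no earlier copy; these two positions cost at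
  -- most two runs each.
  let few := [N + 1, N + 2]
  let rest := List.range (N + 1) ++ List.range' (N + 3) (k + 1)
  have hrest : ∀ i, i ∈ rest ↔ i ≤ N ∨ (N + 2 < i ∧ i ≤ N + (k + 3)) := by
    intro i
    simp only [rest, List.mem_append, List.mem_range, List.mem_range'_1]
    omega
  have hfew : ∀ i ∈ few ++ rest, i ≤ v.length := by
    intro i hi
    rw [List.mem_append, hrest] at hi
    simp only [few, List.mem_cons, List.not_mem_nil, or_false] at hi
    omega
  have hnd : (few ++ rest).Nodup := by
    simp only [few, rest, List.nodup_append, List.nodup_range,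
      List.mem_append, List.mem_range, List.mem_range'_1, List.mem_cons, List.not_mem_nil,
      List.nodup_cons]
    grind
  rw [rDollar_eq_sortedRuns]
  calc sortedRuns (fun i => v.drop i) (label v) (List.range (v.length + 1))
      ≤ sortedRuns (fun i => v.drop i) (label v) (few ++ rest) := by
        refine sortedRuns_mono _ _ (fun i hi => ?_) hfew hnd
        rw [List.mem_append, hrest]
        simp only [few, List.mem_cons, List.not_mem_nil, or_false]
        rw [List.mem_range] at hi
        omega
    _ ≤ sortedRuns (fun i => v.drop i) (label v) rest + 2 * few.length :=
        sortedRuns_append_le _ fun i hi j hj => drop_injOn _ (hfew i hi) (hfew j hj)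
    _ ≤ baseRuns k [b] + 4 := by
        refine Nat.add_le_add_right ?_ 4
        refine sortedRuns_le_of_monotone (fun i => if i ≤ N then i else i - 2 * k) ?_ ?_ ?_ ?_
          List.nodup_range
        · intro i hi
          rw [hrest] at hi
          rw [List.mem_range]
          split_ifs <;> omega
        · intro i hi j hj hij
          rw [hrest] at hi hj
          have hbase : ∀ i t, N + 2 < i → i ≤ N + (k + 3) → t ≤ N → v.drop i ≤ v.drop t →
              v.drop i ++ z ≤ v.drop t := fun i t h1 h2 h3 h => by
            refine append_least_le hk (List.drop_suffix _ _) ?_ h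
            rw [List.length_drop, List.length_drop]
            omega
          change v.drop (if i ≤ N then i else i - 2 * k) ≤ v.drop (if j ≤ N then j else j - 2 * k)
          split_ifs with h1 h2 h2
          · exact hij
          · rw [(hdrop j (by omega) (by omega)).1]
            exact le_trans hij (le_append_right_self _ _)
          · rw [(hdrop i (by omega) (by omega)).1]
            exact hbase i j (by omega) (by omega) h2 hij
          · rw [(hdrop i (by omega) (by omega)).1]
            refine hbase i _ (by omega) (by omega) (by omega) ?_
            rw [(hdrop j (by omega) (by omega)).1]
            exact le_trans hij (le_append_right_self _ _)
        · intro i hi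
          rw [hrest] at hi
          change label v (if i ≤ N then i else i - 2 * k) = label v i
          split_ifs with h1
          · rfl
          · exact (hdrop i (by omega) (by omega)).2
        · intro i hi j hj
          rw [List.mem_range] at hi hj
          exact drop_injOn v (by omega) (by omega)

end AppendB

/-! ### Length of `w_k` and the final estimates -/

section Theta

theorem two_mul_length_wk {k : ℕ} (hk : 2 ≤ k) : 2 * (wk k).length + 18 = 3 * k ^ 2 + 7 * k := by
  rw [length_wk]
  induction k, hk using Nat.le_induction with
  | base => simp [lastBlock]
  | succ k hk ih =>
    -- The added factor `s_k e_k` has `(k + 3) + (2k + 1)` letters.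
    have h : lastBlock (k + 1) = lastBlock k + (3 * k + 4) := by
      obtain ⟨n, rfl⟩ := Nat.exists_eq_add_of_le' hk
      have e1 : n + 2 + 1 - 2 = n + 1 := by omega
      have e2 : n + 2 - 2 = n := by omega
      simp only [lastBlock, e1, e2, List.range'_1_concat, List.flatMap_append,
        List.length_append]
      simp [s, e]
      ring
    rw [h]
    linarith

theorem isThetaSqrtLength_of_linear {f : List Letter → ℤ}
    (h : ∀ k : ℕ, 5 < k → 2 * (k : ℤ) - 10 ≤ f (wk k ++ [b]) ∧ f (wk k ++ [b]) ≤ 2 * k + 8) :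
    IsThetaSqrtLength family f := by
  -- With `k ≤ √n ≤ 2k`, the bounds needed are `k/3 ≤ 2k - 10`, an equality at `k = 6`, and `2k + 8
  -- ≤ 4k`.
  refine ⟨1 / 6, 4, by norm_num, by norm_num, ?_⟩
  rintro _ ⟨k, hk, rfl⟩
  obtain ⟨h1, h2⟩ := h k hk
  have h1' : 2 * (k : ℝ) - 10 ≤ f (wk k ++ [b]) := by exact_mod_cast h1
  have h2' : (f (wk k ++ [b]) : ℝ) ≤ 2 * k + 8 := by exact_mod_cast h2
  have hl : 2 * ((wk k).length : ℝ) + 18 = 3 * k ^ 2 + 7 * k := by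
    exact_mod_cast two_mul_length_wk (show 2 ≤ k by omega)
  have hk' : (6 : ℝ) ≤ k := by exact_mod_cast hk
  have hn : ((wk k ++ [b]).length : ℝ) = (wk k).length + 1 := by simp
  have hlow : (k : ℝ) ≤ Real.sqrt ((wk k ++ [b]).length : ℝ) := by
    apply Real.le_sqrt_of_sq_le
    rw [hn]
    nlinarith
  have hup : Real.sqrt ((wk k ++ [b]).length : ℝ) ≤ 2 * k := by
    rw [Real.sqrt_le_left (by linarith), hn]
    nlinarith
  constructor <;> linarith

theorem infinite_family : family.Infinite := by
  refine Set.infinite_of_injective_forall_mem (f := fun n : ℕ => wk (n + 6) ++ [b]) ?_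
    fun n => ⟨n + 6, by omega, rfl⟩
  intro m n hmn
  have h := congrArg List.length hmn
  have hm := two_mul_length_wk (show 2 ≤ m + 6 by omega)
  have hn := two_mul_length_wk (show 2 ≤ n + 6 by omega)
  simp only [List.length_append, Nat.add_right_cancel_iff] at h
  rw [h] at hm
  nlinarith [hm.symm.trans hn]

theorem rDollar_sub_bounds {k : ℕ} (hk : 5 < k) {x : List Letter} (hx : x.length ≤ 2)
    (h : baseRuns k x + 2 * (k - 3) ≤ rDollar (wk k ++ x)) :
    2 * (k : ℤ) - 10 ≤ (rDollar (wk k ++ x) : ℤ) - rDollar (wk k ++ [b]) ∧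
      (rDollar (wk k ++ x) : ℤ) - rDollar (wk k ++ [b]) ≤ 2 * k + 8 := by
  have h1 := rDollar_le k x
  have h2 := rDollar_append_b_le hk
  have h3 := baseRuns_le_rDollar k [b]
  have h4 := baseRuns_eq hk x [b]
  omega

end Theta

end BWTRuns

theorem mainTheorem7 :
    BWTRuns.family.Infinite ∧
    BWTRuns.IsThetaSqrtLength BWTRuns.family
      (fun w => (BWTRuns.rDollar (w ++ [BWTRuns.b]) : ℤ) - (BWTRuns.rDollar w : ℤ)) ∧
    BWTRuns.IsThetaSqrtLength BWTRuns.family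
      (fun w => (BWTRuns.rDollar w.dropLast : ℤ) - (BWTRuns.rDollar w : ℤ)) ∧
    BWTRuns.IsThetaSqrtLength BWTRuns.family
      (fun w => (BWTRuns.rDollar (w.dropLast ++ [BWTRuns.a]) : ℤ) - (BWTRuns.rDollar w : ℤ)) := by
  refine ⟨BWTRuns.infinite_family,
    BWTRuns.isThetaSqrtLength_of_linear fun k hk => ?_,
    BWTRuns.isThetaSqrtLength_of_linear fun k hk => ?_,
    BWTRuns.isThetaSqrtLength_of_linear fun k hk => ?_⟩
  · simpa using BWTRuns.rDollar_sub_bounds hk (by simp) (BWTRuns.le_rDollar_bb hk)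
  · simpa using BWTRuns.rDollar_sub_bounds hk (by simp)
      (BWTRuns.le_rDollar_replicate_a hk (r := 0) (by omega))
  · simpa using BWTRuns.rDollar_sub_bounds hk (by simp)
      (BWTRuns.le_rDollar_replicate_a hk (r := 1) (by omega))
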